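/- Let $I\subset\mathbb{R}$ be an open interval, $\alpha<\beta$ with $[\alpha,\beta]\subset I$. Let $D\in C^1(I)$ satisfy $D\ge d$ on $I$ for some constant $d>0$, and let $G\in C^3(I)$ satisfy $$G(\alpha)=G(\beta)=G'(\alpha)=G'(\beta)=0,\quad G''(\alpha)>0,\quad G''(\beta)>0,\quad G(s)>0\ \text{ for all } s\in I\setminus\{\alpha,\beta\}.$$ Let $a<b$, $N\in\mathbb{N}$, $r>0$ and $h_1<\dots<h_N$ be such that $h_i+r<h_{i+1}-r$ for $1\le i<N$, $a\le h_i-r$ and $h_i+r\le b$ for $1\le i\le N$. Let $v:[a,b]\to\{\alpha,\beta\}$ be piecewise constant with jumps exactly at $h_1,\dots,h_N$. For $\varepsilon>0$ and $u\in H^1(a,b)$ put $$E_\varepsilon[u]=\int_a^b\Big\{\frac{\varepsilon}{2}\,[D(u)u_x]^2+\frac{G(u)}{\varepsilon}\Big\}\,dx,\qquad \gamma_0=\int_\alpha^\beta\sqrt{2G(s)}\,D(s)\,ds,\qquad \lambda=\min\Big\{\frac{G''(\alpha)}{D(\alpha)^2},\frac{G''(\beta)}{D(\beta)^2}\Big\}.$$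 Then $\lambda>0$, and for every $A\in(0,r\sqrt{2\lambda})$ there are $\varepsilon_0,C,\delta>0$, depending only on $I,\alpha,\beta,D,d,G$, on $v$ (that is, on $a,b,N,h_1,\dots,h_N,r,v$) and on $A$, such that the following holds: for all $M_1<M_2$ with $[M_1,M_2]\subset I$ and every $u\in H^1(a,b)$ with $M_1\le u\le M_2$ on $(a,b)$ and $\|u-v\|_{L^1(a,b)}\le\delta$, $$E_\varepsilon[u]\ \ge\ N\gamma_0-C\,e^{-A/\varepsilon}\qquad\text{for all }\varepsilon\in(0,\varepsilon_0).$$ -/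

import Mathlib

open MeasureTheory
open scoped ContDiff

/-- `u'` is a weak derivative of `u` on `(a, b)`: the integration by parts formula holds against every smooth function with compact support in `(a, b)`. -/
def IsWeakDeriv (a b : ℝ) (u u' : ℝ → ℝ) : Prop :=
  ∀ φ : ℝ → ℝ, ContDiff ℝ ∞ φ → HasCompactSupport φ → tsupport φ ⊆ Set.Ioo a b →
    ∫ x in Set.Ioo a b, u x * deriv φ x = - ∫ x in Set.Ioo a b, u' x * φ x

/-- `u ∈ H¹(a, b)` with weak derivative `u'`. The function `u'` is determined by `u` up to a
null set; values of `u` and `u'` outside `(a, b)` play no role. -/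
structure IsH1 (a b : ℝ) (u u' : ℝ → ℝ) : Prop where
  memLp : MemLp u 2 (volume.restrict (Set.Ioo a b))
  memLp_deriv : MemLp u' 2 (volume.restrict (Set.Ioo a b))
  weakDeriv : IsWeakDeriv a b u u'

/-- `G` is a double-well potential on `I` with nondegenerate wells `α`, `β` of equal depth. -/
structure IsDoubleWell (I : Set ℝ) (α β : ℝ) (G : ℝ → ℝ) : Prop where
  left : G α = 0
  right : G β = 0
  deriv_left : deriv G α = 0
  deriv_right : deriv G β = 0
  deriv2_left : 0 < deriv (deriv G) α
  deriv2_right : 0 < deriv (deriv G) β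
  pos : ∀ s ∈ I, s ≠ α → s ≠ β → 0 < G s

/-- `v : [a, b] → {α, β}` is piecewise constant and its jumps are exactly the `N` points
`h 0 < ⋯ < h (N - 1)`. The intervals `[h i - r, h i + r]` are pairwise disjoint and
contained in `[a, b]`. The values of `v` at the jump points are not prescribed. -/
structure IsTransitionProfile (a b α β : ℝ) (N : ℕ) (h : Fin N → ℝ) (r : ℝ)
    (v : ℝ → ℝ) : Prop where
  r_pos : 0 < r
  separated : ∀ i j : Fin N, i < j → h i + r < h j - r
  left_le : ∀ i, a ≤ h i - r
  le_right : ∀ i, h i + r ≤ b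
  values : ∀ x ∈ Set.Icc a b, v x = α ∨ v x = β
  const : ∀ x ∈ Set.Icc a b, ∀ y ∈ Set.Icc a b, (∀ i, h i ∉ Set.Icc x y) → x ≤ y → v x = v y
  jump : ∀ i, ∀ x ∈ Set.Icc a b, ∀ y ∈ Set.Icc a b, x < h i → h i < y →
    (∀ j, j ≠ i → h j ∉ Set.Icc x y) → v x ≠ v y

/-- The energy `E_ε[u] = ∫_a^b (ε/2 [D(u) u']² + G(u)/ε) dx`. -/
noncomputable def energy (a b : ℝ) (D G : ℝ → ℝ) (ε : ℝ) (u u' : ℝ → ℝ) : ℝ :=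
  ∫ x in Set.Ioo a b, (ε / 2 * (D (u x) * u' x) ^ 2 + G (u x) / ε)

/-- The transition cost `γ₀ = ∫_α^β √(2 G(s)) D(s) ds`. -/
noncomputable def transitionCost (α β : ℝ) (D G : ℝ → ℝ) : ℝ :=
  ∫ s in α..β, √(2 * G s) * D s

/-- `λ = min {G''(α) / D(α)², G''(β) / D(β)²}`. -/
noncomputable def decayRate (α β : ℝ) (D G : ℝ → ℝ) : ℝ :=
  min (deriv (deriv G) α / D α ^ 2) (deriv (deriv G) β / D β ^ 2)

open scoped Topology

/-! Let W(s) = ∫_α^s √(2G) D. By Young's inequality the energy density dominates |(W ∘ U)'|, where U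
is the absolutely continuous representative of u. Closeness in L¹ to v gives points s < h_i < t,
within κ of the jump, at which U is near the two wells. For a rising jump the energy on [s, t] is at
least W(U s) less than W(U t), so what is missing from γ₀ is W(U s) and γ₀ - W(U t). Both are small,
but not exponentially small.

They are recovered from the outer intervals, of length at least r - κ
(`cost_le_integral_energyDensity`). Near a well W ≤ K G (`exists_cost_bounds`), so lingering there
without reaching the well costs energy. This is measured with τ = tanh((t - z)/(Kε)), for which Kε
τ' = 1 - τ²: the term τ' W is at most (1 - τ²) G/ε, and Young's inequality bounds τ W' U' by the
kinetic term plus τ² G/ε. Hence (τ W(U))' is at most the density. Integration recovers the missing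
cost up to a factor tanh, and 1 - tanh decays exponentially.

At a well the ratio of cost to G tends to D/√G'' ≤ 1/√λ, so any K > 1/√λ is admissible; K = √(2/λ)
yields the range A < r√(2λ). The bounds M₁, M₂ serve only to justify absolute continuity and
integrability, so no constant depends on them. -/

/-! ### Absolutely continuous representatives of H¹ functions -/

/-- A smooth function with compact support in `(a, b)` and zero integral has a primitive that is
again smooth with compact support in `(a, b)`. -/
lemma exists_primitive_hasCompactSupport {a b : ℝ} {k : ℝ → ℝ}
    (hk : ContDiff ℝ ∞ k) {p q : ℝ} (hap : a < p) (hqb : q < b) (hpq : p ≤ q)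
    (hsupp : ∀ x, x ∉ Set.Icc p q → k x = 0) (hint : ∫ x, k x = 0) :
    ∃ φ : ℝ → ℝ, ContDiff ℝ ∞ φ ∧ HasCompactSupport φ ∧ tsupport φ ⊆ Set.Ioo a b ∧
      deriv φ = k := by
  have hder : ∀ x, HasDerivAt (fun x => ∫ t in a..x, k t) (k x) x := fun x =>
    intervalIntegral.integral_hasDerivAt_right (hk.continuous.intervalIntegrable _ _)
      hk.continuous.stronglyMeasurable.stronglyMeasurableAtFilter hk.continuous.continuousAt
  have hderiv : deriv (fun x => ∫ t in a..x, k t) = k := funext fun x => (hder x).deriv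
  have hzero : ∀ x, x ∉ Set.Icc p q → ∫ t in a..x, k t = 0 := by
    intro x hx
    rw [Set.mem_Icc, not_and_or, not_le, not_le] at hx
    rcases hx with hx | hx
    · rw [intervalIntegral.integral_congr (g := fun _ => 0), intervalIntegral.integral_zero]
      intro t ht
      refine hsupp t fun h => ?_
      rcases Set.mem_uIcc.1 ht with h' | h' <;> linarith [h.1, h'.1, h'.2]
    · rw [intervalIntegral.integral_of_le (by linarith), ← hint]
      refine setIntegral_eq_integral_of_forall_compl_eq_zero fun t ht => hsupp t fun h => ht ?_
      exact ⟨by linarith [h.1], by linarith [h.2]⟩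
  have hts : tsupport (fun x => ∫ t in a..x, k t) ⊆ Set.Icc p q :=
    closure_minimal (fun x hx => by by_contra h; exact hx (hzero x h)) isClosed_Icc
  refine ⟨_, ?_, isCompact_Icc.of_isClosed_subset (isClosed_tsupport _) hts,
    hts.trans (Set.Icc_subset_Ioo hap hqb), hderiv⟩
  exact contDiff_infty_iff_deriv.2 ⟨fun x => (hder x).differentiableAt, by rwa [hderiv]⟩

/-- The du Bois-Reymond lemma. -/
lemma exists_ae_eq_const_of_integral_mul_deriv_eq_zero {a b : ℝ} (hab : a < b) {f : ℝ → ℝ}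
    (hf : IntegrableOn f (Set.Ioo a b))
    (h : ∀ φ : ℝ → ℝ, ContDiff ℝ ∞ φ → HasCompactSupport φ → tsupport φ ⊆ Set.Ioo a b →
      ∫ x in Set.Ioo a b, f x * deriv φ x = 0) :
    ∃ c : ℝ, ∀ᵐ x ∂(volume.restrict (Set.Ioo a b)), f x = c := by
  let χb : ContDiffBump ((a + b) / 2) := ⟨(b - a) / 8, (b - a) / 4, by linarith, by linarith⟩
  set χ : ℝ → ℝ := χb.normed volume with hχ
  have hχs : ContDiff ℝ ∞ χ := χb.contDiff_normed
  have hχ1 : ∫ x, χ x = 1 := χb.integral_normed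
  have hχi : Integrable χ := χb.integrable_normed
  have hχt : tsupport χ = Set.Icc ((a + b) / 2 - (b - a) / 4) ((a + b) / 2 + (b - a) / 4) := by
    rw [hχ, χb.tsupport_normed_eq, Real.closedBall_eq_Icc]
  have hmulint : ∀ g : ℝ → ℝ, Continuous g → IntegrableOn (fun x => f x * g x) (Set.Ioo a b) := by
    intro g hg
    rw [← integrableOn_Icc_iff_integrableOn_Ioo] at hf ⊢
    exact hf.mul_continuousOn hg.continuousOn isCompact_Icc
  refine ⟨∫ x in Set.Ioo a b, f x * χ x, ?_⟩
  set c := ∫ x in Set.Ioo a b, f x * χ x with hc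
  have key : ∀ᵐ x : ℝ, x ∈ Set.Ioo a b → f x - c = 0 := by
    refine isOpen_Ioo.ae_eq_zero_of_integral_contDiff_smul_eq_zero
      (hf.sub (integrableOn_const (by simp))).locallyIntegrableOn ?_
    intro g hg hgc hgs
    have hgi : Integrable g := hg.continuous.integrable_of_hasCompactSupport hgc
    set K := tsupport g ∪ tsupport χ with hK
    have hKc : IsCompact K := IsCompact.union hgc (by rw [hχt]; exact isCompact_Icc)
    have hKs : K ⊆ Set.Ioo a b := Set.union_subset hgs (by
      rw [hχt]; exact Set.Icc_subset_Ioo (by linarith) (by linarith))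
    have hKn : K.Nonempty := ⟨(a + b) / 2, Or.inr (by
      rw [hχt]; exact ⟨by linarith, by linarith⟩)⟩
    have hKI : K ⊆ Set.Icc (sInf K) (sSup K) := fun x hx =>
      ⟨csInf_le hKc.bddBelow hx, le_csSup hKc.bddAbove hx⟩
    -- Subtracting (∫ g) χ makes the integral vanish, so the result is the derivative of a test
    -- function.
    obtain ⟨φ, hφ, hφc, hφs, hφd⟩ := exists_primitive_hasCompactSupport
      (k := fun x => g x - (∫ x, g x) * χ x) (hg.sub (contDiff_const.mul hχs))
      (hKs (hKc.sInf_mem hKn)).1 (hKs (hKc.sSup_mem hKn)).2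
      (csInf_le_csSup hKn hKc.bddBelow hKc.bddAbove)
      (fun x hx => by
        have h1 : x ∉ K := fun h' => hx (hKI h')
        rw [hK, Set.mem_union, not_or] at h1
        rw [image_eq_zero_of_notMem_tsupport h1.1, image_eq_zero_of_notMem_tsupport h1.2]; simp)
      (by rw [integral_sub hgi (hχi.const_mul _), integral_const_mul, hχ1]; ring)
    have h0 := h φ hφ hφc hφs
    rw [hφd] at h0
    have h1 : ∫ x, g x = ∫ x in Set.Ioo a b, g x :=
      (setIntegral_eq_integral_of_forall_compl_eq_zero fun x hx =>
        image_eq_zero_of_notMem_tsupport fun h' => hx (hgs h')).symm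
    have h2 : ∫ x, g x • (f x - c) = ∫ x in Set.Ioo a b, g x • (f x - c) :=
      (setIntegral_eq_integral_of_forall_compl_eq_zero fun x hx => by
        rw [image_eq_zero_of_notMem_tsupport fun h' => hx (hgs h'), zero_smul]).symm
    rw [h2]
    have h3 : ∫ x in Set.Ioo a b, g x • (f x - c) =
        (∫ x in Set.Ioo a b, f x * g x) - ∫ x in Set.Ioo a b, c * g x := by
      rw [← integral_sub (hmulint g hg.continuous) (hgi.integrableOn.const_mul c)]
      congr 1; ext x; rw [smul_eq_mul]; ring
    have h4 : ∫ x in Set.Ioo a b, f x * (g x - (∫ x, g x) * χ x) =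
        (∫ x in Set.Ioo a b, f x * g x) - ∫ x in Set.Ioo a b, (∫ x, g x) * (f x * χ x) := by
      rw [← integral_sub (hmulint g hg.continuous) ((hmulint χ hχs.continuous).const_mul _)]
      congr 1; ext x; ring
    rw [h4, integral_const_mul, ← hc] at h0
    rw [h3, integral_const_mul, ← h1]
    linarith
  rw [ae_restrict_iff' measurableSet_Ioo]
  filter_upwards [key] with x hx hx'
  linarith [hx hx']

/-- A function in `H¹(a, b)` has an absolutely continuous representative. -/
lemma IsH1.exists_absolutelyContinuous {a b : ℝ} (hab : a < b) {u u' : ℝ → ℝ}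
    (hu : IsH1 a b u u') :
    ∃ U : ℝ → ℝ, AbsolutelyContinuousOnInterval U a b ∧
      (∀ᵐ x ∂(volume.restrict (Set.Ioo a b)), u x = U x) ∧
      ∀ᵐ x ∂(volume.restrict (Set.Ioo a b)), HasDerivAt U (u' x) x := by
  have hui : IntegrableOn u (Set.Ioo a b) := hu.memLp.integrable (by norm_num)
  have hui' : IntegrableOn u' (Set.Ioo a b) := hu.memLp_deriv.integrable (by norm_num)
  have hii : IntervalIntegrable u' volume a b := by
    rwa [intervalIntegrable_iff_integrableOn_Ioo_of_le hab.le]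
  set V : ℝ → ℝ := fun x => ∫ t in a..x, u' t with hV
  have hVac : AbsolutelyContinuousOnInterval V a b :=
    hii.absolutelyContinuousOnInterval_intervalIntegral Set.left_mem_uIcc
  have hVd : ∀ᵐ x : ℝ, x ∈ Set.Ioo a b → HasDerivAt V (u' x) x := by
    filter_upwards [hii.ae_hasDerivAt_integral] with x hx hx'
    exact hx (by rw [Set.uIcc_of_le hab.le]; exact Set.Ioo_subset_Icc_self hx') a Set.left_mem_uIcc
  have hVc : ContinuousOn V (Set.Icc a b) := by
    rw [← Set.uIcc_of_le hab.le]; exact hVac.continuousOn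
  have hVi : IntegrableOn V (Set.Ioo a b) :=
    hVc.integrableOn_Icc.mono_set Set.Ioo_subset_Icc_self
  -- Both `u` and the primitive `V` have weak derivative `u'`, so they differ by a constant.
  obtain ⟨c, hc⟩ := exists_ae_eq_const_of_integral_mul_deriv_eq_zero hab
    (f := fun x => u x - V x) (hui.sub hVi) (by
      intro φ hφ hφc hφs
      have hdφ : Continuous (deriv φ) := (contDiff_infty_iff_deriv.1 hφ).2.continuous
      have hm : ∀ f : ℝ → ℝ, IntegrableOn f (Set.Ioo a b) →
          IntegrableOn (fun x => f x * deriv φ x) (Set.Ioo a b) := by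
        intro f hf
        rw [← integrableOn_Icc_iff_integrableOn_Ioo] at hf ⊢
        exact hf.mul_continuousOn hdφ.continuousOn isCompact_Icc
      have hφa : φ a = 0 := image_eq_zero_of_notMem_tsupport fun h' => lt_irrefl _ (hφs h').1
      have hφb : φ b = 0 := image_eq_zero_of_notMem_tsupport fun h' => lt_irrefl _ (hφs h').2
      have hφac : AbsolutelyContinuousOnInterval φ a b :=
        (hφ.of_le (by norm_cast)).contDiffOn.absolutelyContinuousOnInterval
      have h1 := hVac.integral_mul_deriv_eq_deriv_mul hφac
      rw [hφa, hφb, intervalIntegral.integral_of_le hab.le, intervalIntegral.integral_of_le hab.le,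
        integral_Ioc_eq_integral_Ioo, integral_Ioc_eq_integral_Ioo] at h1
      have h2 : ∫ x in Set.Ioo a b, deriv V x * φ x = ∫ x in Set.Ioo a b, u' x * φ x := by
        refine setIntegral_congr_ae measurableSet_Ioo ?_
        filter_upwards [hVd] with x hx hx'
        rw [(hx hx').deriv]
      have h3 := hu.weakDeriv φ hφ hφc hφs
      simp only [sub_mul]
      rw [integral_sub (hm u hui) (hm V hVi), h1, h2, h3]
      ring)
  refine ⟨fun x => c + V x, ?_, ?_, ?_⟩
  · have : AbsolutelyContinuousOnInterval (fun _ : ℝ => c) a b :=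
      contDiffOn_const.absolutelyContinuousOnInterval
    exact this.add hVac
  · filter_upwards [hc] with x hx
    linarith
  · rw [ae_restrict_iff' measurableSet_Ioo]
    filter_upwards [hVd] with x hx hx'
    exact (hx hx').const_add c

/-! ### Estimates for tanh -/

lemma hasDerivAt_tanh (x : ℝ) : HasDerivAt Real.tanh (1 - Real.tanh x ^ 2) x := by
  have h : Real.tanh = fun x => Real.sinh x / Real.cosh x := funext Real.tanh_eq_sinh_div_cosh
  have hc := (Real.cosh_pos x).ne'
  have hd := (Real.hasDerivAt_sinh x).fun_div (Real.hasDerivAt_cosh x) hc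
  rw [← h] at hd
  refine hd.congr_deriv ?_
  rw [Real.tanh_eq_sinh_div_cosh]
  field_simp

lemma one_sub_tanh_le (x : ℝ) : 1 - Real.tanh x ≤ 2 * Real.exp (-(2 * x)) := by
  have hc := Real.cosh_pos x
  have h1 : 1 - Real.tanh x = Real.exp (-x) / Real.cosh x := by
    rw [Real.tanh_eq_sinh_div_cosh, ← Real.cosh_sub_sinh]; field_simp
  have h2 : Real.exp x / 2 ≤ Real.cosh x := by
    rw [Real.cosh_eq]; linarith [Real.exp_pos (-x)]
  rw [h1, div_le_iff₀ hc]
  calc Real.exp (-x) = 2 * Real.exp (-(2 * x)) * (Real.exp x / 2) := by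
        rw [mul_assoc, mul_div_assoc', ← Real.exp_add, mul_div_cancel₀ _ two_ne_zero]
        congr 1; ring
    _ ≤ _ := by gcongr

lemma tanh_sq_le_one (x : ℝ) : Real.tanh x ^ 2 ≤ 1 := by
  have hc := Real.cosh_pos x
  rw [Real.tanh_eq_sinh_div_cosh, div_pow, div_le_one (by positivity)]
  linarith [Real.cosh_sq x]

/-! ### Lower energy bounds by calibration -/

/-- `U` is absolutely continuous on `[a, b]` with derivative `U'` almost everywhere. -/
structure IsACWithDeriv (a b : ℝ) (U U' : ℝ → ℝ) : Prop where
  ac : AbsolutelyContinuousOnInterval U a b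
  hasDerivAt : ∀ᵐ x ∂(volume.restrict (Set.Ioo a b)), HasDerivAt U (U' x) x

lemma AbsolutelyContinuousOnInterval.lipschitzOnWith_comp {a b : ℝ} {U W : ℝ → ℝ} {s : Set ℝ}
    {K : NNReal} (hU : AbsolutelyContinuousOnInterval U a b) (hs : Set.MapsTo U (Set.uIcc a b) s)
    (hW : LipschitzOnWith K W s) : AbsolutelyContinuousOnInterval (fun x => W (U x)) a b := by
  rw [absolutelyContinuousOnInterval_iff] at hU ⊢
  intro ε hε
  obtain ⟨δ, hδ, h⟩ := hU (ε / (K + 1)) (by positivity)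
  refine ⟨δ, hδ, fun E hE hEδ => ?_⟩
  have hE' := h E hE hEδ
  calc ∑ i ∈ Finset.range E.1, dist (W (U (E.2 i).1)) (W (U (E.2 i).2))
      ≤ ∑ i ∈ Finset.range E.1, K * dist (U (E.2 i).1) (U (E.2 i).2) :=
        Finset.sum_le_sum fun i hi =>
          hW.dist_le_mul _ (hs (hE.1 i hi).1) _ (hs (hE.1 i hi).2)
    _ = K * ∑ i ∈ Finset.range E.1, dist (U (E.2 i).1) (U (E.2 i).2) := by
        rw [Finset.mul_sum]
    _ ≤ K * (ε / (K + 1)) := by gcongr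
    _ < (K + 1) * (ε / (K + 1)) := by gcongr; linarith
    _ = ε := by field_simp

/-- The integrand of the energy. -/
noncomputable def energyDensity (D G : ℝ → ℝ) (ε : ℝ) (U U' : ℝ → ℝ) (x : ℝ) : ℝ :=
  ε / 2 * (D (U x) * U' x) ^ 2 + G (U x) / ε

/-- `W` is a primitive of `√(2 G) D` up to sign. -/
structure IsCost (I : Set ℝ) (D G W W' : ℝ → ℝ) : Prop where
  hasDerivAt : ∀ s ∈ I, HasDerivAt W (W' s) s
  continuousOn : ContinuousOn W' I
  sq_eq : ∀ s ∈ I, W' s ^ 2 = 2 * G s * D s ^ 2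

/-- Only the square of `W'` is prescribed, so the sign is free. This and `IsCost.const_sub` let one
estimate serve both wells and both directions of transition. -/
lemma IsCost.neg {I : Set ℝ} {D G W W' : ℝ → ℝ} (h : IsCost I D G W W') :
    IsCost I D G (fun s => - W s) (fun s => - W' s) where
  hasDerivAt s hs := (h.hasDerivAt s hs).neg
  continuousOn := h.continuousOn.neg
  sq_eq s hs := by rw [neg_sq, h.sq_eq s hs]

lemma IsCost.const_sub {I : Set ℝ} {D G W W' : ℝ → ℝ} (h : IsCost I D G W W') (c : ℝ) :
    IsCost I D G (fun s => c - W s) (fun s => - W' s) where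
  hasDerivAt s hs := (h.hasDerivAt s hs).const_sub c
  continuousOn := h.continuousOn.neg
  sq_eq s hs := by rw [neg_sq, h.sq_eq s hs]

lemma IsCost.exists_lipschitzOnWith {I : Set ℝ} {D G W W' : ℝ → ℝ} (h : IsCost I D G W W')
    {M₁ M₂ : ℝ} (hM : Set.Icc M₁ M₂ ⊆ I) : ∃ K, LipschitzOnWith K W (Set.Icc M₁ M₂) := by
  obtain ⟨C, hC⟩ := isCompact_Icc.exists_bound_of_continuousOn (h.continuousOn.mono hM)
  refine ⟨C.toNNReal, (convex_Icc M₁ M₂).lipschitzOnWith_of_nnnorm_hasDerivWithin_le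
    (fun x hx => (h.hasDerivAt x (hM hx)).hasDerivWithinAt) fun x hx => ?_⟩
  rw [← norm_toNNReal]
  exact Real.toNNReal_le_toNNReal (hC x hx)

/-- Young's inequality for the energy density. -/
lemma IsCost.mul_le {I : Set ℝ} {D G W W' : ℝ → ℝ} (h : IsCost I D G W W') {s ε : ℝ} (hs : s ∈ I)
    (hε : 0 < ε) (hGs : 0 ≤ G s) (c p : ℝ) :
    c * W' s * p ≤ ε / 2 * (D s * p) ^ 2 + c ^ 2 * G s / ε := by
  refine abs_le_of_sq_le_sq' ?_ (by positivity) |>.2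
  have h1 : (c * W' s * p) ^ 2 = 4 * (ε / 2 * (D s * p) ^ 2) * (c ^ 2 * G s / ε) := by
    rw [mul_pow, mul_pow, h.sq_eq s hs]; field_simp; ring
  rw [h1]
  nlinarith [sq_nonneg (ε / 2 * (D s * p) ^ 2 - c ^ 2 * G s / ε)]

/-- Lower bound for the energy by a calibration `τ(t) W(U(t))`. -/
lemma sub_le_integral_of_calibration {a b x y : ℝ} {U U' τ τ' e W W' D G : ℝ → ℝ}
    {I : Set ℝ} {M₁ M₂ : ℝ} (hU : IsACWithDeriv a b U U') (hax : a ≤ x) (hxy : x ≤ y) (hyb : y ≤ b)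
    (hM : Set.Icc M₁ M₂ ⊆ I) (hUM : Set.MapsTo U (Set.Icc a b) (Set.Icc M₁ M₂))
    (hW : IsCost I D G W W') (hτ : ∀ t, HasDerivAt τ (τ' t) t) (hτ' : Continuous τ')
    (he : IntegrableOn e (Set.Ioo a b))
    (hle : ∀ t ∈ Set.Ioo x y, τ' t * W (U t) + τ t * (W' (U t) * U' t) ≤ e t) :
    τ y * W (U y) - τ x * W (U x) ≤ ∫ t in x..y, e t := by
  have hsub : Set.uIcc x y ⊆ Set.uIcc a b := by
    rw [Set.uIcc_of_le hxy, Set.uIcc_of_le (by linarith)]; exact Set.Icc_subset_Icc hax hyb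
  -- The Lipschitz bound makes τ W(U) absolutely continuous, hence the integral of its derivative;
  -- its size does not enter the estimate.
  obtain ⟨K, hK⟩ := hW.exists_lipschitzOnWith hM
  have hτC : ContDiff ℝ 1 τ := by
    rw [contDiff_one_iff_deriv]
    refine ⟨fun t => (hτ t).differentiableAt, ?_⟩
    rwa [show deriv τ = τ' from funext fun t => (hτ t).deriv]
  have hac : AbsolutelyContinuousOnInterval (fun t => τ t * W (U t)) x y :=
    hτC.contDiffOn.absolutelyContinuousOnInterval.fun_mul
      ((hU.ac.lipschitzOnWith_comp (by rwa [Set.uIcc_of_le (by linarith)]) hK).mono hsub)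
  rw [← hac.integral_deriv_eq_sub, intervalIntegral.integral_of_le hxy,
    intervalIntegral.integral_of_le hxy, integral_Ioc_eq_integral_Ioo,
    integral_Ioc_eq_integral_Ioo]
  have hdi := hac.intervalIntegrable_deriv
  rw [intervalIntegrable_iff_integrableOn_Ioo_of_le hxy] at hdi
  have hss : Set.Ioo x y ⊆ Set.Ioo a b := Set.Ioo_subset_Ioo hax hyb
  refine setIntegral_mono_ae_restrict hdi (he.mono_set hss) ?_
  filter_upwards [ae_restrict_of_ae_restrict_of_subset hss hU.hasDerivAt,
    ae_restrict_mem measurableSet_Ioo] with t ht htI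
  have hUt : U t ∈ I := hM (hUM (Set.Ioo_subset_Icc_self (hss htI)))
  have hd := (hτ t).mul ((hW.hasDerivAt (U t) hUt).comp t ht)
  have : deriv (fun t => τ t * W (U t)) t = τ' t * W (U t) + τ t * (W' (U t) * U' t) := hd.deriv
  rw [this]
  exact hle t htI

section

variable {a b x y ε : ℝ} {U U' W W' D G : ℝ → ℝ} {I : Set ℝ} {M₁ M₂ : ℝ}

lemma sub_le_integral_energyDensity (hU : IsACWithDeriv a b U U') (hax : a ≤ x) (hxy : x ≤ y)
    (hyb : y ≤ b) (hM : Set.Icc M₁ M₂ ⊆ I) (hUM : Set.MapsTo U (Set.Icc a b) (Set.Icc M₁ M₂))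
    (hG : ∀ s ∈ I, 0 ≤ G s) (hε : 0 < ε) (hW : IsCost I D G W W')
    (he : IntegrableOn (energyDensity D G ε U U') (Set.Ioo a b)) :
    W (U y) - W (U x) ≤ ∫ t in x..y, energyDensity D G ε U U' t := by
  have := sub_le_integral_of_calibration (τ := fun _ => 1) (τ' := fun _ => 0) hU hax hxy hyb hM hUM
    hW (fun t => hasDerivAt_const t 1) continuous_const he (fun t ht => by
      have hUt : U t ∈ I := hM (hUM ⟨hax.trans ht.1.le, ht.2.le.trans hyb⟩)
      have := hW.mul_le hUt hε (hG _ hUt) 1 (U' t)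
      simp only [energyDensity]
      rw [one_pow, one_mul, one_mul] at this
      linarith)
  simpa using this

/-- A trajectory with `0 < W ≤ K G` on `[x, y]`, calibrated by `τ = tanh ((t - z) / (K ε))`. -/
lemma tanh_mul_sub_le_integral_energyDensity {K z : ℝ} (hU : IsACWithDeriv a b U U')
    (hax : a ≤ x) (hxy : x ≤ y) (hyb : y ≤ b) (hM : Set.Icc M₁ M₂ ⊆ I)
    (hUM : Set.MapsTo U (Set.Icc a b) (Set.Icc M₁ M₂))
    (hG : ∀ s ∈ I, 0 ≤ G s) (hε : 0 < ε) (hK : 0 < K) (hW : IsCost I D G W W')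
    (he : IntegrableOn (energyDensity D G ε U U') (Set.Ioo a b))
    (hWK : ∀ t ∈ Set.Icc x y, 0 < W (U t) ∧ W (U t) ≤ K * G (U t)) :
    Real.tanh ((y - z) / (K * ε)) * W (U y) - Real.tanh ((x - z) / (K * ε)) * W (U x) ≤
      ∫ t in x..y, energyDensity D G ε U U' t := by
  have hlin : ∀ t, HasDerivAt (fun t => (t - z) / (K * ε)) (1 / (K * ε)) t := fun t => by
    simpa using ((hasDerivAt_id t).sub_const z).div_const (K * ε)
  have htc : Continuous Real.tanh :=
    continuous_iff_continuousAt.2 fun x => (hasDerivAt_tanh x).continuousAt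
  refine sub_le_integral_of_calibration (τ := fun t => Real.tanh ((t - z) / (K * ε)))
    (τ' := fun t => (1 - Real.tanh ((t - z) / (K * ε)) ^ 2) * (1 / (K * ε)))
    hU hax hxy hyb hM hUM hW (fun t => (hasDerivAt_tanh _).comp t (hlin t)) (by fun_prop) he ?_
  intro t ht
  have hUt : U t ∈ I := hM (hUM ⟨hax.trans ht.1.le, ht.2.le.trans hyb⟩)
  obtain ⟨hW0, hWle⟩ := hWK t (Set.Ioo_subset_Icc_self ht)
  set T := Real.tanh ((t - z) / (K * ε))
  -- Young's inequality with weight `T` spends the fraction T² of G/ε; the remaining 1 - T² absorbs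
  -- the term with τ'.
  have h1 := hW.mul_le hUt hε (hG _ hUt) T (U' t)
  have hT : 0 ≤ 1 - T ^ 2 := sub_nonneg.2 (tanh_sq_le_one _)
  have h2 : (1 - T ^ 2) * (1 / (K * ε)) * W (U t) ≤ (1 - T ^ 2) * (G (U t) / ε) := by
    rw [mul_assoc]
    refine mul_le_mul_of_nonneg_left ?_ hT
    calc 1 / (K * ε) * W (U t) ≤ 1 / (K * ε) * (K * G (U t)) := by gcongr
      _ = G (U t) / ε := by field_simp
  simp only [energyDensity]
  calc _ ≤ (1 - T ^ 2) * (G (U t) / ε) + (ε / 2 * (D (U t) * U' t) ^ 2 + T ^ 2 * G (U t) / ε) := by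
        linarith
    _ = _ := by ring

/-- The density is nonnegative, so [x, y] may be shrunk to the interval between `p` and `q`; when
`q` precedes `p`, the bound is applied to -W. -/
lemma sub_le_integral_energyDensity_of_mem {p q : ℝ} (hU : IsACWithDeriv a b U U') (hax : a ≤ x)
    (hyb : y ≤ b) (hM : Set.Icc M₁ M₂ ⊆ I) (hUM : Set.MapsTo U (Set.Icc a b) (Set.Icc M₁ M₂))
    (hG : ∀ s ∈ I, 0 ≤ G s) (hε : 0 < ε) (hW : IsCost I D G W W')
    (he : IntegrableOn (energyDensity D G ε U U') (Set.Ioo a b)) (hp : p ∈ Set.Icc x y)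
    (hq : q ∈ Set.Icc x y) :
    W (U q) - W (U p) ≤ ∫ t in x..y, energyDensity D G ε U U' t := by
  have hmono : ∀ p q, x ≤ p → p ≤ q → q ≤ y → ∫ t in p..q, energyDensity D G ε U U' t ≤
      ∫ t in x..y, energyDensity D G ε U U' t := by
    intro p q hp hpq hq
    rw [intervalIntegral.integral_of_le hpq, intervalIntegral.integral_of_le (by linarith),
      integral_Ioc_eq_integral_Ioo, integral_Ioc_eq_integral_Ioo]
    refine setIntegral_mono_set (he.mono_set (Set.Ioo_subset_Ioo hax hyb)) ?_
      (Set.Ioo_subset_Ioo hp hq).eventuallyLE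
    filter_upwards [ae_restrict_mem measurableSet_Ioo] with t ht
    have := hG _ (hM (hUM ⟨hax.trans ht.1.le, ht.2.le.trans hyb⟩))
    simp only [energyDensity, Pi.zero_apply]
    positivity
  rcases le_total p q with h | h
  · exact (sub_le_integral_energyDensity hU (hax.trans hp.1) h (hq.2.trans hyb) hM hUM hG hε hW
      he).trans (hmono p q hp.1 h hq.2)
  · have := (sub_le_integral_energyDensity hU (hax.trans hq.1) h (hp.2.trans hyb) hM hUM hG hε
      hW.neg he).trans (hmono q p hq.1 h hp.2)
    linarith

/-- The energy of a trajectory on `[x, y]` whose endpoint `p` is near a well. -/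
lemma cost_le_integral_energyDensity {K η p : ℝ} (hU : IsACWithDeriv a b U U')
    (hax : a ≤ x) (hxy : x ≤ y) (hyb : y ≤ b) (hM : Set.Icc M₁ M₂ ⊆ I)
    (hUM : Set.MapsTo U (Set.Icc a b) (Set.Icc M₁ M₂))
    (hG : ∀ s ∈ I, 0 ≤ G s) (hε : 0 < ε) (hK : 0 < K) (hη : 0 < η) (hW : IsCost I D G W W')
    (he : IntegrableOn (energyDensity D G ε U U') (Set.Ioo a b))
    (hWK : ∀ s ∈ I, 0 < W s → W s < η → W s ≤ K * G s) (hp : p = x ∨ p = y)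
    (hpη : W (U p) ≤ η / 2) :
    W (U p) ≤ (∫ t in x..y, energyDensity D G ε U U' t) +
      η * Real.exp (-(2 * ((y - x) / (K * ε)))) := by
  have hexp : 0 < η * Real.exp (-(2 * ((y - x) / (K * ε)))) := by positivity
  have hpI : p ∈ Set.Icc x y := by rcases hp with rfl | rfl <;> simp [hxy]
  -- If W(U) stays in (0, η), the tanh calibration applies. Otherwise W(U) reaches a value ≥ η or ≤
  -- 0, and the change in cost from `p` is already at least W(U p): in the first case because W(U p)
  -- ≤ η/2.
  by_cases h : ∀ t ∈ Set.Icc x y, 0 < W (U t) ∧ W (U t) < η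
  · have h1 := fun z => tanh_mul_sub_le_integral_energyDensity (z := z) hU hax hxy hyb hM
      hUM hG hε hK hW he (fun t ht => ⟨(h t ht).1, hWK _
        (hM (hUM ⟨hax.trans ht.1, ht.2.trans hyb⟩)) (h t ht).1 (h t ht).2⟩)
    have h2 := one_sub_tanh_le ((y - x) / (K * ε))
    have h4 : Real.tanh ((y - x) / (K * ε)) * W (U p) ≤
        ∫ t in x..y, energyDensity D G ε U U' t := by
      -- Centring tanh at the endpoint opposite to `p` kills the boundary term there.
      rcases hp with rfl | rfl
      · have := h1 y
        rw [show (p - y) / (K * ε) = -((y - p) / (K * ε)) by ring, Real.tanh_neg, sub_self,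
          zero_div, Real.tanh_zero] at this
        linarith
      · have := h1 x
        rw [sub_self,
          zero_div, Real.tanh_zero] at this
        linarith
    nlinarith [mul_le_mul_of_nonneg_left h2 (h p hpI).1.le, mul_le_mul_of_nonneg_right hpη
      (Real.exp_pos (-(2 * ((y - x) / (K * ε))))).le]
  · push Not at h
    obtain ⟨t, ht, ht'⟩ := h
    by_cases h0 : 0 < W (U t)
    · have := sub_le_integral_energyDensity_of_mem hU hax hyb hM hUM hG hε hW he hpI ht
      linarith [ht' h0]
    · have := sub_le_integral_energyDensity_of_mem hU hax hyb hM hUM hG hε hW he ht hpI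
      linarith

end

/-! ### Cost against potential near the wells -/

lemma nonneg_of_hasDerivAt_nonneg {f f' : ℝ → ℝ} {p q : ℝ}
    (hf : ∀ s ∈ Set.Icc p q, HasDerivAt f (f' s) s) (hf' : ∀ s ∈ Set.Icc p q, 0 ≤ f' s)
    (hp : f p = 0) : ∀ s ∈ Set.Icc p q, 0 ≤ f s := by
  intro s hs
  have hmono : MonotoneOn f (Set.Icc p q) := by
    refine monotoneOn_of_deriv_nonneg (convex_Icc p q)
      (fun s hs => (hf s hs).continuousAt.continuousWithinAt)
      (fun s hs => (hf s (interior_subset hs)).differentiableAt.differentiableWithinAt)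
      fun s hs => ?_
    rw [(hf s (interior_subset hs)).deriv]
    exact hf' s (interior_subset hs)
  rw [← hp]
  exact hmono ⟨le_rfl, hs.1.trans hs.2⟩ hs hs.1

/-- To the right of a nondegenerate well `p` the cost `W` is controlled by the potential. -/
lemma exists_cost_le_mul_potential {G G₁ G₂ D W : ℝ → ℝ} {p K : ℝ} {J : Set ℝ} (hJ : J ∈ 𝓝 p)
    (hG : ∀ s ∈ J, HasDerivAt G (G₁ s) s) (hG₁ : ∀ s ∈ J, HasDerivAt G₁ (G₂ s) s)
    (hW : ∀ s ∈ J, HasDerivAt W (√(2 * G s) * D s) s)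
    (hG₂ : ContinuousAt G₂ p) (hD : ContinuousAt D p) (hGp : G p = 0) (hG₁p : G₁ p = 0)
    (hG₂p : 0 < G₂ p) (hWp : W p = 0) (hK : 0 < K) (hKp : D p ^ 2 < K ^ 2 * G₂ p) :
    ∃ ρ > 0, ∀ s ∈ Set.Icc p (p + ρ), W s ≤ K * G s := by
  obtain ⟨m, hm₁, hm₂⟩ := exists_between hKp
  have hev : ∀ᶠ s in 𝓝 p, s ∈ J ∧ 0 < G₂ s ∧ D s ^ 2 < m ∧ m < K ^ 2 * G₂ s := by
    filter_upwards [hJ, hG₂.eventually_const_lt hG₂p, (hD.pow 2).eventually_lt_const hm₁,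
      (hG₂.const_mul (K ^ 2)).eventually_const_lt hm₂] with s h1 h2 h3 h4
    exact ⟨h1, h2, h3, h4⟩
  obtain ⟨ρ, hρ, h⟩ := Metric.eventually_nhds_iff.1 hev
  refine ⟨ρ / 2, by positivity, ?_⟩
  have h' : ∀ s ∈ Set.Icc p (p + ρ / 2),
      s ∈ J ∧ 0 < G₂ s ∧ D s ^ 2 < m ∧ m < K ^ 2 * G₂ s := by
    intro s hs
    refine h ?_
    rw [Real.dist_eq, abs_lt]
    constructor <;> linarith [hs.1, hs.2]
  have hG₁n := nonneg_of_hasDerivAt_nonneg (fun s hs => hG₁ s (h' s hs).1)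
    (fun s hs => (h' s hs).2.1.le) hG₁p
  have hGn := nonneg_of_hasDerivAt_nonneg (fun s hs => hG s (h' s hs).1) hG₁n hGp
  -- Two successive comparisons: K² G₁² ≥ 2mG, and D² < m then gives √(2G) D ≤ K G₁, which is the
  -- differentiated form of W ≤ K G.
  have hR := nonneg_of_hasDerivAt_nonneg (f := fun s => K ^ 2 * G₁ s ^ 2 - 2 * m * G s)
    (f' := fun s => 2 * G₁ s * (K ^ 2 * G₂ s - m)) (p := p) (q := p + ρ / 2)
    (fun s hs => by
      refine ((((hG₁ s (h' s hs).1).fun_pow 2).const_mul (K ^ 2)).sub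
        ((hG s (h' s hs).1).const_mul (2 * m))).congr_deriv ?_
      push_cast; ring)
    (fun s hs => mul_nonneg (mul_nonneg zero_le_two (hG₁n s hs)) (by linarith [(h' s hs).2.2.2]))
    (by simp [hGp, hG₁p])
  have hQ := nonneg_of_hasDerivAt_nonneg (f := fun s => K * G s - W s)
    (f' := fun s => K * G₁ s - √(2 * G s) * D s) (p := p) (q := p + ρ / 2)
    (fun s hs => ((hG s (h' s hs).1).const_mul K).sub (hW s (h' s hs).1))
    (fun s hs => by
      have h1 := hGn s hs
      have h2 : (√(2 * G s) * D s) ^ 2 ≤ (K * G₁ s) ^ 2 := by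
        rw [mul_pow, mul_pow, Real.sq_sqrt (by linarith)]
        nlinarith [hR s hs, (h' s hs).2.2.1]
      linarith [(abs_le_of_sq_le_sq' h2 (mul_nonneg hK.le (hG₁n s hs))).2])
    (by simp [hGp, hWp])
  intro s hs
  linarith [hQ s hs]

section

variable {I : Set ℝ} {α β d : ℝ} {D G : ℝ → ℝ}

lemma IsDoubleWell.nonneg (hGwell : IsDoubleWell I α β G) : ∀ s ∈ I, 0 ≤ G s := by
  intro s hs
  by_cases h1 : s = α
  · rw [h1, hGwell.left]
  by_cases h2 : s = β
  · rw [h2, hGwell.right]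
  exact (hGwell.pos s hs h1 h2).le

lemma decayRate_pos (hαβ : α < β) (hαβI : Set.Icc α β ⊆ I) (hd : 0 < d) (hDd : ∀ s ∈ I, d ≤ D s)
    (hGwell : IsDoubleWell I α β G) : 0 < decayRate α β D G := by
  have h1 := hd.trans_le (hDd α (hαβI ⟨le_rfl, hαβ.le⟩))
  have h2 := hd.trans_le (hDd β (hαβI ⟨hαβ.le, le_rfl⟩))
  have h3 := hGwell.deriv2_left
  have h4 := hGwell.deriv2_right
  exact lt_min (by positivity) (by positivity)

lemma intervalIntegrable_cost (hI : I.OrdConnected) (hD : ContinuousOn D I)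
    (hG : ContinuousOn G I) {x y : ℝ} (hx : x ∈ I) (hy : y ∈ I) :
    IntervalIntegrable (fun s => √(2 * G s) * D s) volume x y :=
  (((hG.const_smul (2 : ℝ)).sqrt.mul hD).mono (hI.uIcc_subset hx hy)).intervalIntegrable

lemma isCost_transitionCost (hI_open : IsOpen I) (hI : I.OrdConnected) (hα : α ∈ I)
    (hD : ContinuousOn D I) (hG : ContinuousOn G I) (hGnn : ∀ s ∈ I, 0 ≤ G s) :
    IsCost I D G (fun s => transitionCost α s D G) (fun s => √(2 * G s) * D s) where
  hasDerivAt s hs := by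
    have hc : ContinuousOn (fun s => √(2 * G s) * D s) I := (hG.const_smul (2 : ℝ)).sqrt.mul hD
    exact intervalIntegral.integral_hasDerivAt_right (intervalIntegrable_cost hI hD hG hα hs)
      (hc.stronglyMeasurableAtFilter hI_open s hs) (hc.continuousAt (hI_open.mem_nhds hs))
  continuousOn := (hG.const_smul (2 : ℝ)).sqrt.mul hD
  sq_eq s hs := by rw [mul_pow, Real.sq_sqrt (by linarith [hGnn s hs])]

lemma transitionCost_sub (hI : I.OrdConnected) (hα : α ∈ I) (hD : ContinuousOn D I)
    (hG : ContinuousOn G I) {x y : ℝ} (hx : x ∈ I) (hy : y ∈ I) :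
    transitionCost α y D G - transitionCost α x D G = transitionCost x y D G :=
  intervalIntegral.integral_interval_sub_left (intervalIntegrable_cost hI hD hG hα hy)
    (intervalIntegrable_cost hI hD hG hα hx)

lemma transitionCost_mono (hI : I.OrdConnected) (hα : α ∈ I) (hD : ContinuousOn D I)
    (hG : ContinuousOn G I) (hDnn : ∀ s ∈ I, 0 ≤ D s) {x y : ℝ} (hx : x ∈ I) (hy : y ∈ I)
    (hxy : x ≤ y) : transitionCost α x D G ≤ transitionCost α y D G := by
  rw [← sub_nonneg, transitionCost_sub hI hα hD hG hx hy]
  exact intervalIntegral.integral_nonneg hxy fun s hs =>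
    mul_nonneg (Real.sqrt_nonneg _) (hDnn s (hI.out hx hy hs))

lemma transitionCost_lt (hI : I.OrdConnected) (hα : α ∈ I) (hD : ContinuousOn D I)
    (hG : ContinuousOn G I) (hd : 0 < d) (hDd : ∀ s ∈ I, d ≤ D s)
    {x y : ℝ} (hx : x ∈ I) (hy : y ∈ I) (hxy : x < y) (hGpos : ∀ s ∈ Set.Ioo x y, 0 < G s) :
    transitionCost α x D G < transitionCost α y D G := by
  rw [← sub_pos, transitionCost_sub hI hα hD hG hx hy]
  refine intervalIntegral.intervalIntegral_pos_of_pos_on (intervalIntegrable_cost hI hD hG hx hy)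
    (fun s hs => ?_) hxy
  have h1 := hGpos s hs
  have h2 := hd.trans_le (hDd s (hI.out hx hy (Set.Ioo_subset_Icc_self hs)))
  positivity

lemma lt_mul_deriv2_of_inv_decayRate_lt {K : ℝ} (hK : 1 < K ^ 2 * decayRate α β D G)
    (hDα : 0 < D α) (hDβ : 0 < D β) :
    D α ^ 2 < K ^ 2 * deriv (deriv G) α ∧ D β ^ 2 < K ^ 2 * deriv (deriv G) β := by
  have key : ∀ g δ : ℝ, 0 < δ → decayRate α β D G ≤ g / δ ^ 2 → δ ^ 2 < K ^ 2 * g := by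
    intro g δ hδ h
    have h1 : K ^ 2 * decayRate α β D G ≤ K ^ 2 * (g / δ ^ 2) := by gcongr
    have h2 := hK.trans_le h1
    rw [← mul_div_assoc, lt_div_iff₀ (by positivity)] at h2
    linarith
  exact ⟨key _ _ hDα (min_le_left _ _), key _ _ hDβ (min_le_right _ _)⟩

lemma exists_cost_bounds (hI_open : IsOpen I) (hI : I.OrdConnected) (hαβ : α < β)
    (hαβI : Set.Icc α β ⊆ I) (hd : 0 < d) (hD : ContinuousOn D I) (hDd : ∀ s ∈ I, d ≤ D s)
    (hG : ContDiffOn ℝ 2 G I) (hGwell : IsDoubleWell I α β G) {K : ℝ} (hK : 0 < K)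
    (hKlam : 1 < K ^ 2 * decayRate α β D G) :
    ∃ η > 0, (∀ s ∈ I, 0 < transitionCost α s D G → transitionCost α s D G < η →
        transitionCost α s D G ≤ K * G s) ∧
      ∀ s ∈ I, 0 < transitionCost α β D G - transitionCost α s D G →
        transitionCost α β D G - transitionCost α s D G < η →
        transitionCost α β D G - transitionCost α s D G ≤ K * G s := by
  have hα : α ∈ I := hαβI ⟨le_rfl, hαβ.le⟩
  have hβ : β ∈ I := hαβI ⟨hαβ.le, le_rfl⟩
  have hGc := hG.continuousOn
  have hG1c : ContDiffOn ℝ 1 (deriv G) I := hG.deriv_of_isOpen hI_open (by norm_num)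
  have hG2c : ContinuousOn (deriv (deriv G)) I := hG1c.continuousOn_deriv_of_isOpen hI_open le_rfl
  have hG1 : ∀ s ∈ I, HasDerivAt G (deriv G s) s := fun s hs =>
    ((hG.differentiableOn (by norm_num)).differentiableAt (hI_open.mem_nhds hs)).hasDerivAt
  have hG2 : ∀ s ∈ I, HasDerivAt (deriv G) (deriv (deriv G) s) s := fun s hs =>
    ((hG1c.differentiableOn (by norm_num)).differentiableAt (hI_open.mem_nhds hs)).hasDerivAt
  have hW := isCost_transitionCost hI_open hI hα hD hGc hGwell.nonneg
  have hDnn : ∀ s ∈ I, 0 ≤ D s := fun s hs => hd.le.trans (hDd s hs)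
  have hWα : transitionCost α α D G = 0 := intervalIntegral.integral_same
  obtain ⟨hKα, hKβ⟩ := lt_mul_deriv2_of_inv_decayRate_lt hKlam
    (hd.trans_le (hDd α hα)) (hd.trans_le (hDd β hβ))
  obtain ⟨ρ₁, hρ₁, h₁⟩ := exists_cost_le_mul_potential (hI_open.mem_nhds hα) hG1 hG2 hW.hasDerivAt
    (hG2c.continuousAt (hI_open.mem_nhds hα)) (hD.continuousAt (hI_open.mem_nhds hα))
    hGwell.left hGwell.deriv_left hGwell.deriv2_left hWα hK hKα
  -- The reflection s ↦ -s reduces the left side of β to the right side of a well.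
  have hJ : IsOpen {s : ℝ | -s ∈ I} := hI_open.preimage continuous_neg
  have hβJ : -β ∈ {s : ℝ | -s ∈ I} := by simpa using hβ
  have hneg : ∀ {f : ℝ → ℝ}, ContinuousAt f β → ContinuousAt (fun s => f (-s)) (-β) := fun hf =>
    ContinuousAt.comp (x := -β) (f := fun s : ℝ => -s) (by simpa using hf)
      continuous_neg.continuousAt
  obtain ⟨ρ₂, hρ₂, h₂⟩ := exists_cost_le_mul_potential (G := fun s => G (-s))
    (G₁ := fun s => - deriv G (-s)) (G₂ := fun s => deriv (deriv G) (-s)) (D := fun s => D (-s))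
    (W := fun s => transitionCost α β D G - transitionCost α (-s) D G) (K := K)
    (hJ.mem_nhds hβJ)
    (fun s hs => ((hG1 (-s) hs).comp s (hasDerivAt_neg s)).congr_deriv (by ring))
    (fun s hs => ((hG2 (-s) hs).comp s (hasDerivAt_neg s)).neg.congr_deriv (by ring))
    (fun s hs => (((hW.hasDerivAt (-s) hs).comp s (hasDerivAt_neg s)).const_sub _).congr_deriv
      (by ring))
    (hneg (hG2c.continuousAt (hI_open.mem_nhds hβ))) (hneg (hD.continuousAt (hI_open.mem_nhds hβ)))
    (by simp [hGwell.right]) (by simp [hGwell.deriv_right]) (by simpa using hGwell.deriv2_right)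
    (by simp) hK (by simpa using hKβ)
  set ρ := min (min ρ₁ ρ₂) (β - α) with hρdef
  have hρ : 0 < ρ := lt_min (lt_min hρ₁ hρ₂) (sub_pos.2 hαβ)
  have hρl₁ : ρ ≤ ρ₁ := (min_le_left _ _).trans (min_le_left _ _)
  have hρl₂ : ρ ≤ ρ₂ := (min_le_left _ _).trans (min_le_right _ _)
  have hρl : ρ ≤ β - α := min_le_right _ _
  have hαρ : α + ρ ∈ I := hαβI ⟨by linarith, by linarith⟩
  have hβρ : β - ρ ∈ I := hαβI ⟨by linarith, by linarith⟩
  have hGpos : ∀ s ∈ Set.Ioo α β, 0 < G s := fun s hs =>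
    hGwell.pos s (hαβI (Set.Ioo_subset_Icc_self hs)) hs.1.ne' hs.2.ne
  have hηα := transitionCost_lt hI hα hD hGc hd hDd hα hαρ (by linarith)
    (fun s hs => hGpos s ⟨hs.1, by linarith [hs.2]⟩)
  have hηβ := transitionCost_lt hI hα hD hGc hd hDd hβρ hβ (by linarith)
    (fun s hs => hGpos s ⟨by linarith [hs.1], hs.2⟩)
  have hmono := fun {x y : ℝ} => transitionCost_mono hI hα hD hGc hDnn (x := x) (y := y)
  -- With this η, monotonicity of the cost confines `s` to [α, α + ρ], respectively [β - ρ, β], even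
  -- though `s` ranges over all of `I`.
  refine ⟨min (transitionCost α (α + ρ) D G)
    (transitionCost α β D G - transitionCost α (β - ρ) D G),
    lt_min (by linarith) (by linarith), fun s hs h0 hlt => ?_, fun s hs h0 hlt => ?_⟩
  · refine h₁ s ⟨?_, ?_⟩
    · by_contra! h
      linarith [hmono hs hα h.le]
    · by_contra! h
      linarith [hmono hαρ hs (by linarith), hlt.trans_le (min_le_left _ _)]
  · have := h₂ (-s) ⟨?_, ?_⟩
    · simpa using this
    · by_contra! h
      linarith [hmono hβ hs (by linarith)]
    · by_contra! h
      linarith [hmono hs hβρ (by linarith), hlt.trans_le (min_le_right _ _)]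

end

/-! ### The step profile and consequences of L¹ closeness -/

/-- Off the finite set of jumps, `v` is locally constant, hence continuous; it is bounded by its two
values. -/
lemma IsTransitionProfile.integrableOn {a b α β r : ℝ} {N : ℕ} {h : Fin N → ℝ} {v : ℝ → ℝ}
    (hv : IsTransitionProfile a b α β N h r v) : IntegrableOn v (Set.Ioo a b) := by
  have hfin : (Set.range h).Finite := Set.finite_range h
  have hopen : IsOpen (Set.Ioo a b \ Set.range h) := isOpen_Ioo.sdiff hfin.isClosed
  have hcont : ContinuousOn v (Set.Ioo a b \ Set.range h) := by
    intro x hx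
    refine ContinuousAt.continuousWithinAt ?_
    obtain ⟨ρ, hρ, hball⟩ := Metric.isOpen_iff.1 hopen x hx
    refine (continuousAt_const (y := v x)).congr ?_
    filter_upwards [Metric.ball_mem_nhds x hρ] with y hy
    have hmem : ∀ z, |z - x| ≤ |y - x| → z ∈ Set.Ioo a b \ Set.range h := fun z hz =>
      hball (by rw [Metric.mem_ball, Real.dist_eq] at hy ⊢; linarith)
    have hIcc : ∀ z, z ∈ Set.Ioo a b \ Set.range h → z ∈ Set.Icc a b := fun z hz =>
      Set.Ioo_subset_Icc_self hz.1
    rcases le_total x y with hxy | hxy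
    · refine hv.const x (hIcc x hx) y (hIcc y (hball hy)) (fun i hi => ?_) hxy
      exact (hmem (h i) (abs_le_abs_of_nonneg (by linarith [hi.1]) (by linarith [hi.2]))).2 ⟨i, rfl⟩
    · refine (hv.const y (hIcc y (hball hy)) x (hIcc x hx) (fun i hi => ?_) hxy).symm
      exact (hmem (h i) (abs_le_abs_of_nonpos (by linarith [hi.2]) (by linarith [hi.1]))).2 ⟨i, rfl⟩
  have hae : Set.Ioo a b \ Set.range h =ᵐ[volume] Set.Ioo a b :=
    sdiff_null_ae_eq_self (hfin.measure_zero volume)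
  have hmeas : AEStronglyMeasurable v (volume.restrict (Set.Ioo a b)) := by
    rw [← Measure.restrict_congr_set hae]
    exact hcont.aestronglyMeasurable hopen.measurableSet
  refine Integrable.of_bound hmeas (max |α| |β|) ?_
  filter_upwards [ae_restrict_mem measurableSet_Ioo] with x hx
  rcases hv.values x (Set.Ioo_subset_Icc_self hx) with h | h <;> simp [h]

/-- Near a jump point the profile takes one of the two values on each side. -/
lemma IsTransitionProfile.eq_or_eq {a b α β r : ℝ} {N : ℕ} {h : Fin N → ℝ} {v : ℝ → ℝ}
    (hv : IsTransitionProfile a b α β N h r v) (i : Fin N) :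
    ((∀ x ∈ Set.Ioo (h i - r) (h i), v x = α) ∧ ∀ x ∈ Set.Ioo (h i) (h i + r), v x = β) ∨
      ((∀ x ∈ Set.Ioo (h i - r) (h i), v x = β) ∧ ∀ x ∈ Set.Ioo (h i) (h i + r), v x = α) := by
  have hr := hv.r_pos
  have hl := hv.left_le i
  have hb := hv.le_right i
  have hval : ∀ x ∈ Set.Ioo (h i - r) (h i + r), v x = α ∨ v x = β := fun x hx =>
    hv.values x ⟨by linarith [hx.1], by linarith [hx.2]⟩
  have hne : ∀ x ∈ Set.Ioo (h i - r) (h i), ∀ y ∈ Set.Ioo (h i) (h i + r), v x ≠ v y := by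
    intro x hx y hy
    refine hv.jump i x ⟨by linarith [hx.1], by linarith [hx.2]⟩ y
      ⟨by linarith [hy.1], by linarith [hy.2]⟩ hx.2 hy.1 fun j hj hmem => ?_
    rcases lt_or_gt_of_ne hj with hlt | hlt
    · linarith [hv.separated j i hlt, hmem.1, hx.1]
    · linarith [hv.separated i j hlt, hmem.2, hy.2]
  have hx₀ : h i - r / 2 ∈ Set.Ioo (h i - r) (h i) := ⟨by linarith, by linarith⟩
  have hy₀ : h i + r / 2 ∈ Set.Ioo (h i) (h i + r) := ⟨by linarith, by linarith⟩
  have hvl : ∀ x ∈ Set.Ioo (h i - r) (h i), v x = α ∨ v x = β := fun x hx =>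
    hval x ⟨hx.1, by linarith [hx.2]⟩
  have hvr : ∀ x ∈ Set.Ioo (h i) (h i + r), v x = α ∨ v x = β := fun x hx =>
    hval x ⟨by linarith [hx.1], hx.2⟩
  -- There are only two values, and each value on the left differs from each on the right, so both
  -- sides are constant.
  grind

/-- A function that is `L¹`-close to a constant is close to it at some point. -/
lemma exists_abs_sub_lt {a b x y θ δ p : ℝ} {f v : ℝ → ℝ} (hax : a ≤ x) (hxy : x ≤ y) (hyb : y ≤ b)
    (hf : IntegrableOn (fun t => f t - v t) (Set.Ioo a b))
    (hδ : ∫ t in Set.Ioo a b, |f t - v t| ≤ δ) (hlt : δ < θ * (y - x))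
    (hv : ∀ t ∈ Set.Ioo x y, v t = p) : ∃ t ∈ Set.Ioo x y, |f t - p| < θ := by
  by_contra! hcon
  have hss : Set.Ioo x y ⊆ Set.Ioo a b := Set.Ioo_subset_Ioo hax hyb
  have hfa : IntegrableOn (fun t => |f t - v t|) (Set.Ioo a b) := Integrable.abs hf
  have h1 : ∫ _ in Set.Ioo x y, θ ≤ ∫ t in Set.Ioo x y, |f t - v t| :=
    setIntegral_mono_on (integrableOn_const (by simp)) (hfa.mono_set hss)
      measurableSet_Ioo fun t ht => by rw [hv t ht]; exact hcon t ht
  have h2 : ∫ t in Set.Ioo x y, |f t - v t| ≤ ∫ t in Set.Ioo a b, |f t - v t| :=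
    setIntegral_mono_set hfa (Filter.Eventually.of_forall fun t => abs_nonneg _)
      hss.eventuallyLE
  rw [setIntegral_const, Real.volume_real_Ioo_of_le hxy, smul_eq_mul] at h1
  linarith

/-- A set of full measure is dense, and closed bounds pass to limits along a continuous function. -/
lemma mapsTo_Icc_of_ae_restrict {a b M₁ M₂ : ℝ} (hab : a < b) {U : ℝ → ℝ}
    (hU : ContinuousOn U (Set.Icc a b))
    (h : ∀ᵐ x ∂(volume.restrict (Set.Ioo a b)), U x ∈ Set.Icc M₁ M₂) :
    Set.MapsTo U (Set.Icc a b) (Set.Icc M₁ M₂) := by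
  rw [ae_restrict_iff' measurableSet_Ioo] at h
  have hdense : Dense {x | x ∈ Set.Ioo a b → U x ∈ Set.Icc M₁ M₂} := Measure.dense_of_ae h
  intro x hx
  have hx' : x ∈ closure (Set.Ioo a b ∩ {x | x ∈ Set.Ioo a b → U x ∈ Set.Icc M₁ M₂}) := by
    rw [← closure_Ioo hab.ne] at hx
    exact closure_minimal (hdense.open_subset_closure_inter isOpen_Ioo) isClosed_closure hx
  have := ((hU x hx).mono (Set.inter_subset_left.trans Set.Ioo_subset_Icc_self)).mem_closure hx'
    (fun y hy => hy.2 hy.1)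
  rwa [isClosed_Icc.closure_eq] at this

lemma integrableOn_energyDensity {a b ε : ℝ} {D G U U' : ℝ → ℝ}
    (hU' : MemLp U' 2 (volume.restrict (Set.Ioo a b)))
    (hD : ContinuousOn (fun x => D (U x)) (Set.Icc a b))
    (hG : ContinuousOn (fun x => G (U x)) (Set.Icc a b)) :
    IntegrableOn (energyDensity D G ε U U') (Set.Ioo a b) := by
  refine Integrable.add ?_ ?_
  · have h1 : IntegrableOn (fun x => U' x ^ 2) (Set.Icc a b) := by
      rw [integrableOn_Icc_iff_integrableOn_Ioo]; exact hU'.integrable_sq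
    have h2 := (h1.mul_continuousOn (hD.pow 2) isCompact_Icc).mono_set Set.Ioo_subset_Icc_self
    refine (h2.const_mul (ε / 2)).congr (Filter.Eventually.of_forall fun x => ?_)
    simp only [Pi.pow_apply]
    ring
  · exact (hG.integrableOn_Icc.mono_set Set.Ioo_subset_Icc_self).div_const ε

/-! ### One transition, and summation over the jumps -/

section

variable {a b ε : ℝ} {U U' D G : ℝ → ℝ} {I : Set ℝ} {M₁ M₂ : ℝ}

/-- The energy of one transition. -/
lemma le_integral_energyDensity_of_transition {W W' : ℝ → ℝ} {K η γ h r κ s t : ℝ}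
    (hU : IsACWithDeriv a b U U') (hah : a ≤ h - r) (hhb : h + r ≤ b) (hM : Set.Icc M₁ M₂ ⊆ I)
    (hUM : Set.MapsTo U (Set.Icc a b) (Set.Icc M₁ M₂)) (hG : ∀ s ∈ I, 0 ≤ G s) (hε : 0 < ε)
    (hK : 0 < K) (hη : 0 < η) (hW : IsCost I D G W W')
    (he : IntegrableOn (energyDensity D G ε U U') (Set.Ioo a b))
    (hWK : ∀ s ∈ I, 0 < W s → W s < η → W s ≤ K * G s)
    (hWK' : ∀ s ∈ I, 0 < γ - W s → γ - W s < η → γ - W s ≤ K * G s) (hκ : κ ≤ r)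
    (hs : s ∈ Set.Icc (h - κ) h) (ht : t ∈ Set.Icc h (h + κ)) (hsη : W (U s) ≤ η / 2)
    (htη : γ - W (U t) ≤ η / 2) :
    γ - 2 * η * Real.exp (-(2 * ((r - κ) / (K * ε)))) ≤
      ∫ x in Set.Ioo (h - r) (h + r), energyDensity D G ε U U' x := by
  -- The three pieces contribute W(U s), W(U t) - W(U s) and γ - W(U t), which telescope to γ; each
  -- outer piece loses one exponential term.
  have h1 := cost_le_integral_energyDensity hU hah (by linarith [hs.1])
    (by linarith [hs.2, ht.1, ht.2]) hM hUM hG hε hK hη hW he hWK (Or.inr rfl) hsη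
  have h2 := sub_le_integral_energyDensity hU (by linarith [hs.1]) (hs.2.trans ht.1)
    (by linarith [ht.2]) hM hUM hG hε hW he
  have h3 := cost_le_integral_energyDensity hU (by linarith [hs.1, hs.2, ht.1])
    (by linarith [ht.2] : t ≤ h + r) hhb hM hUM hG hε hK hη (hW.const_sub γ) he hWK'
    (Or.inl rfl) htη
  have hexp : ∀ z, r - κ ≤ z → η * Real.exp (-(2 * (z / (K * ε)))) ≤
      η * Real.exp (-(2 * ((r - κ) / (K * ε)))) := fun z hz => by gcongr
  have h4 := hexp (s - (h - r)) (by linarith [hs.1])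
  have h5 := hexp (h + r - t) (by linarith [ht.2])
  have hii : ∀ p q, a ≤ p → p ≤ q → q ≤ b →
      IntervalIntegrable (energyDensity D G ε U U') volume p q := fun p q hp hpq hq => by
    rw [intervalIntegrable_iff_integrableOn_Ioo_of_le hpq]
    exact he.mono_set (Set.Ioo_subset_Ioo hp hq)
  have hst := hs.2.trans ht.1
  rw [← integral_Ioc_eq_integral_Ioo,
    ← intervalIntegral.integral_of_le (by linarith [hs.1, ht.2]),
    ← intervalIntegral.integral_add_adjacent_intervals (b := t)
      (hii _ _ hah (by linarith [hs.1]) (by linarith [ht.2]))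
      (hii _ _ (by linarith [hs.1]) (by linarith [ht.2]) hhb),
    ← intervalIntegral.integral_add_adjacent_intervals (b := s)
      (hii _ _ hah (by linarith [hs.1]) (by linarith [ht.2]))
      (hii _ _ (by linarith [hs.1]) hst (by linarith [ht.2]))]
  linarith

end

lemma sum_setIntegral_le {ι : Type*} [Fintype ι] {f : ℝ → ℝ} {s : Set ℝ} {t : ι → Set ℝ}
    (hf : IntegrableOn f s) (hfnn : ∀ x ∈ s, 0 ≤ f x) (hs : MeasurableSet s)
    (ht : ∀ i, MeasurableSet (t i)) (hts : ∀ i, t i ⊆ s)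
    (hdisj : Pairwise (Function.onFun Disjoint t)) :
    ∑ i, ∫ x in t i, f x ≤ ∫ x in s, f x := by
  rw [← integral_iUnion_fintype ht hdisj fun i => hf.mono_set (hts i)]
  refine setIntegral_mono_set hf ?_ (Set.iUnion_subset hts).eventuallyLE
  filter_upwards [ae_restrict_mem hs] with x hx using hfnn x hx

theorem mainTheorem2
    -- the state interval and the two wells
    (I : Set ℝ) (hI_open : IsOpen I) (hI_interval : I.OrdConnected)
    (α β : ℝ) (hαβ : α < β) (hαβI : Set.Icc α β ⊆ I)
    -- the diffusivity and the potential
    (D G : ℝ → ℝ) (d : ℝ) (hd : 0 < d)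
    (hD : ContDiffOn ℝ 1 D I) (hDd : ∀ s ∈ I, d ≤ D s)
    (hG : ContDiffOn ℝ 3 G I) (hGwell : IsDoubleWell I α β G)
    -- the step function with `N` transitions
    (a b : ℝ) (hab : a < b) (N : ℕ) (h : Fin N → ℝ) (r : ℝ) (v : ℝ → ℝ)
    (hv : IsTransitionProfile a b α β N h r v) :
    0 < decayRate α β D G ∧
    ∀ A : ℝ, 0 < A → A < r * √(2 * decayRate α β D G) →
      ∃ ε₀ C δ : ℝ, 0 < ε₀ ∧ 0 < C ∧ 0 < δ ∧
        ∀ M₁ M₂ : ℝ, M₁ < M₂ → Set.Icc M₁ M₂ ⊆ I →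
        ∀ u u' : ℝ → ℝ, IsH1 a b u u' →
          (∀ᵐ x ∂(volume.restrict (Set.Ioo a b)), M₁ ≤ u x ∧ u x ≤ M₂) →
          (∫ x in Set.Ioo a b, |u x - v x|) ≤ δ →
          ∀ ε : ℝ, 0 < ε → ε < ε₀ →
            N * transitionCost α β D G - C * Real.exp (-A / ε) ≤ energy a b D G ε u u' := by
  have hlam := decayRate_pos hαβ hαβI hd hDd hGwell
  refine ⟨hlam, fun A hA hAr => ?_⟩
  set lam := decayRate α β D G
  have hα : α ∈ I := hαβI ⟨le_rfl, hαβ.le⟩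
  have hβ : β ∈ I := hαβI ⟨hαβ.le, le_rfl⟩
  have hDc := hD.continuousOn
  have hGc := hG.continuousOn
  have hGnn := hGwell.nonneg
  have hr := hv.r_pos
  -- K = √(2/λ) exceeds the critical 1/√λ and satisfies 2r/K = r√(2λ).
  obtain ⟨K, hK, hK2, hKs⟩ : ∃ K : ℝ, 0 < K ∧ K ^ 2 * lam = 2 ∧ √(2 * lam) * K = 2 := by
    refine ⟨√(2 / lam), by positivity, ?_, ?_⟩
    · rw [Real.sq_sqrt (by positivity)]; field_simp
    · rw [← Real.sqrt_mul (by positivity), show 2 * lam * (2 / lam) = 2 ^ 2 by field_simp,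
        Real.sqrt_sq zero_le_two]
  -- The slack in A < r√(2λ) leaves room for κ > 0 with exponent 2(r - κ)/K exactly A.
  obtain ⟨κ, hκ, hκr, hκA⟩ : ∃ κ > 0, κ ≤ r ∧ 2 * (r - κ) = A * K := by
    refine ⟨r - A * K / 2, ?_, ?_, by ring⟩
    · have := mul_lt_mul_of_pos_right hAr hK
      rw [mul_assoc, hKs] at this
      linarith
    · linarith [mul_pos hA hK]
  obtain ⟨η, hη, hWα, hWβ⟩ := exists_cost_bounds hI_open hI_interval hαβ hαβI hd hDc hDd
    (hG.of_le (by norm_num)) hGwell hK (by rw [hK2]; norm_num)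
  have hW := isCost_transitionCost hI_open hI_interval hα hDc hGc hGnn
  set γ := transitionCost α β D G
  obtain ⟨θ, hθ, hθα, hθβ⟩ : ∃ θ > 0, (∀ s, |s - α| < θ → transitionCost α s D G ≤ η / 2) ∧
      ∀ s, |s - β| < θ → γ - transitionCost α s D G ≤ η / 2 := by
    have h1 : ∀ᶠ s in 𝓝 α, transitionCost α s D G < η / 2 :=
      (hW.hasDerivAt α hα).continuousAt.eventually_lt_const
        (by simpa [transitionCost] using hη)
    have h2 : ∀ᶠ s in 𝓝 β, γ - η / 2 < transitionCost α s D G :=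
      (hW.hasDerivAt β hβ).continuousAt.eventually_const_lt (by simp only [γ]; linarith)
    obtain ⟨θ₁, hθ₁, h1⟩ := Metric.eventually_nhds_iff.1 h1
    obtain ⟨θ₂, hθ₂, h2⟩ := Metric.eventually_nhds_iff.1 h2
    refine ⟨min θ₁ θ₂, lt_min hθ₁ hθ₂, fun s hs => (h1 (hs.trans_le (min_le_left _ _))).le,
      fun s hs => ?_⟩
    linarith [h2 (hs.trans_le (min_le_right _ _))]
  -- Staying θ away from a well on an interval of length κ would cost θκ > δ in L¹. The bound holds
  -- for every ε > 0, so ε₀ = 1 is arbitrary; the + 1 keeps C positive when N = 0.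
  refine ⟨1, 2 * N * η + 1, θ * κ / 2, one_pos, by positivity, by positivity, ?_⟩
  intro M₁ M₂ _ hM u u' hu huM huv ε hε _
  obtain ⟨U, hUac, huU, hUd⟩ := hu.exists_absolutelyContinuous hab
  have hU : IsACWithDeriv a b U u' := ⟨hUac, hUd⟩
  have hUc : ContinuousOn U (Set.Icc a b) := by
    rw [← Set.uIcc_of_le hab.le]; exact hUac.continuousOn
  have hUM : Set.MapsTo U (Set.Icc a b) (Set.Icc M₁ M₂) := by
    refine mapsTo_Icc_of_ae_restrict hab hUc ?_
    filter_upwards [huM, huU] with x h1 h2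
    rwa [h2] at h1
  have hUI : Set.MapsTo U (Set.Icc a b) I := fun x hx => hM (hUM hx)
  have he : IntegrableOn (energyDensity D G ε U u') (Set.Ioo a b) :=
    integrableOn_energyDensity hu.memLp_deriv (hDc.comp hUc hUI) (hGc.comp hUc hUI)
  have henergy : energy a b D G ε u u' = ∫ x in Set.Ioo a b, energyDensity D G ε U u' x := by
    refine integral_congr_ae ?_
    filter_upwards [huU] with x hx
    rw [energyDensity, hx]
  have hUv : IntegrableOn (fun x => U x - v x) (Set.Ioo a b) :=
    (hUc.integrableOn_Icc.mono_set Set.Ioo_subset_Icc_self).sub hv.integrableOn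
  have hUvδ : ∫ x in Set.Ioo a b, |U x - v x| ≤ θ * κ / 2 := by
    refine (integral_congr_ae ?_).trans_le huv
    filter_upwards [huU] with x hx
    rw [hx]
  have hexp : -(2 * (r - κ) / (K * ε)) = -A / ε := by rw [hκA]; field_simp
  have hθκ : 0 < θ * κ := mul_pos hθ hκ
  have hlocal : ∀ i, γ - 2 * η * Real.exp (-A / ε) ≤
      ∫ x in Set.Ioo (h i - r) (h i + r), energyDensity D G ε U u' x := by
    intro i
    have hl := hv.left_le i
    have hb := hv.le_right i
    have hleft : ∀ p, (∀ x ∈ Set.Ioo (h i - r) (h i), v x = p) →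
        ∃ s ∈ Set.Ioo (h i - κ) (h i), |U s - p| < θ := fun p hp =>
      exists_abs_sub_lt (by linarith) (by linarith) (by linarith) hUv hUvδ (by linarith)
        fun x hx => hp x ⟨by linarith [hx.1], hx.2⟩
    have hright : ∀ p, (∀ x ∈ Set.Ioo (h i) (h i + r), v x = p) →
        ∃ s ∈ Set.Ioo (h i) (h i + κ), |U s - p| < θ := fun p hp =>
      exists_abs_sub_lt (by linarith) (by linarith) (by linarith) hUv hUvδ (by linarith)
        fun x hx => hp x ⟨hx.1, by linarith [hx.2]⟩
    rw [← hexp, mul_div_assoc]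
    rcases hv.eq_or_eq i with ⟨h1, h2⟩ | ⟨h1, h2⟩
    · obtain ⟨s, hs, hsθ⟩ := hleft α h1
      obtain ⟨t, ht, htθ⟩ := hright β h2
      exact le_integral_energyDensity_of_transition hU hl hb hM hUM hGnn hε hK hη hW he hWα hWβ hκr
        (Set.Ioo_subset_Icc_self hs) (Set.Ioo_subset_Icc_self ht) (hθα _ hsθ) (hθβ _ htθ)
    -- A falling transition is a rising one for the cost γ - W, with the two wells exchanged.
    · obtain ⟨s, hs, hsθ⟩ := hleft β h1
      obtain ⟨t, ht, htθ⟩ := hright α h2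
      exact le_integral_energyDensity_of_transition hU hl hb hM hUM hGnn hε hK hη (hW.const_sub γ)
        he hWβ (by simpa only [sub_sub_cancel] using hWα) hκr
        (Set.Ioo_subset_Icc_self hs) (Set.Ioo_subset_Icc_self ht) (hθβ _ hsθ)
        (by simpa only [sub_sub_cancel] using hθα _ htθ)
  have hsum := sum_setIntegral_le (t := fun i => Set.Ioo (h i - r) (h i + r)) he
    (fun x hx => by
      have := hGnn _ (hUI (Set.Ioo_subset_Icc_self hx))
      simp only [energyDensity]
      positivity)
    measurableSet_Ioo (fun i => measurableSet_Ioo)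
    (fun i => Set.Ioo_subset_Ioo (hv.left_le i) (hv.le_right i))
    (fun i j hij => Set.disjoint_left.2 fun x hxi hxj => by
      rcases lt_or_gt_of_ne hij with hlt | hlt
      · linarith [hv.separated i j hlt, hxi.2, hxj.1]
      · linarith [hv.separated j i hlt, hxj.2, hxi.1])
  have hconst : ∑ _i : Fin N, (γ - 2 * η * Real.exp (-A / ε)) ≤ _ :=
    Finset.sum_le_sum fun i _ => hlocal i
  rw [Finset.sum_const, Finset.card_univ, Fintype.card_fin, nsmul_eq_mul] at hconst
  rw [henergy]
  nlinarith [Real.exp_pos (-A / ε)]
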